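/- All posets and groups are finite. For a finite poset $P$, let $\Delta(P)$ be its order complex (vertices: the elements of $P$; simplices: the chains of $P$), and let the atoms of $P$ be its minimal elements. For a set $S$ of atoms put $P_{\geqslant S}=\{p\in P : p\geqslant s \text{ for all } s\in S\}$; we say that $S$ generates $P$ if $P_{\geqslant S}=\emptyset$. The poset $P$ is called atomized if, for every nonempty set $S$ of atoms, $P_{\geqslant S}$ is either empty or has a minimum element. Let $M(P)$ be the simplicial complex whose vertices are the atoms of $P$ and whose simplices are the sets of atoms that do not generate $P$. Two simplicial complexes are homotopy equivalent if their geometric realizations are. (1) If $P$ is a finite atomized poset, then $\Delta(P)$ is homotopy equivalent to $M(P)$. (2) Let $G$ be a finite group, let $C(G)$ be the poset of all left cosets of all proper subgroups of $G$, ordered by inclusion (the elements of $C(G)$ are called proper cosets), and let $M(G)$ be the simplicial complex whose nonempty simplices are the nonempty subsets of $G$ that are contained in a proper coset. Then $C(G)$ is atomized, and $\Delta(C(G))$ is homotopy equivalent to $M(G)$. If $G$ is nontrivial, then every element of $G$ is a vertex of $M(G)$, and $g\mapsto\{g\}$ is a bijection from $G$ onto the set of atoms of $C(G)$ that identifies $M(G)$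 with $M(C(G))$. (If $G$ is trivial, then $C(G)$ and $M(G)$ are both empty.) -/

import Mathlib

open scoped ContinuousMap

/-- The geometric realization of a simplicial complex `K` on a finite vertex type: the subspace of
`ℝ^V` of all `t` with nonnegative coordinates, of total sum `1`, whose support is a simplex. -/
def geometricRealization {V : Type*} [Finite V] (K : PreAbstractSimplicialComplex V) :
    Set (V → ℝ) :=
  {t | (∀ v, 0 ≤ t v) ∧ ∃ s ∈ K.faces, (s : Set V) = Function.support t ∧ ∑ v ∈ s, t v = 1}

/-- The order complex `Δ(P)`: its vertices are the elements of `P`, its simplices are the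
(finite, nonempty) chains of `P`. -/
def orderComplex (P : Type*) [PartialOrder P] : AbstractSimplicialComplex P where
  faces := {s | s.Nonempty ∧ IsChain (· ≤ ·) (s : Set P)}
  isRelLowerSet_faces := fun _ hs =>
    ⟨hs.1, fun _ hts ht => ⟨ht, hs.2.mono (Finset.coe_subset.2 hts)⟩⟩
  singleton_mem := fun v => ⟨Finset.singleton_nonempty v, by simp⟩

/-- The atoms of a poset are its minimal elements. -/
def posetAtoms (P : Type*) [PartialOrder P] : Set P := {a | IsMin a}

/-- A set `S` of atoms generates `P` if `P_{≥ S}`, the set of upper bounds of `S`, is empty. -/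
def GeneratesPoset {P : Type*} [PartialOrder P] (S : Set P) : Prop := upperBounds S = ∅

/-- `P` is atomized if, for each nonempty set `S` of minimal elements, `P_{≥ S}` is either empty or
has a minimum element. -/
def IsAtomized (P : Type*) [PartialOrder P] : Prop :=
  ∀ S : Set P, S ⊆ posetAtoms P → S.Nonempty →
    upperBounds S = ∅ ∨ ∃ m, IsLeast (upperBounds S) m

/-- The complex `M(P)`: its vertices are the atoms of `P`, its simplices are the (finite, nonempty)
sets of atoms that do not generate `P`. -/
def minimalCover (P : Type*) [PartialOrder P] : AbstractSimplicialComplex (posetAtoms P) where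
  faces := {s | s.Nonempty ∧ ¬ GeneratesPoset (Subtype.val '' (s : Set (posetAtoms P)))}
  isRelLowerSet_faces := fun _ hs => ⟨hs.1, fun _ hts ht => ⟨ht, fun h => hs.2 <|
    Set.subset_eq_empty (upperBounds_mono_set (Set.image_mono (Finset.coe_subset.2 hts))) h⟩⟩
  singleton_mem := fun v => ⟨Finset.singleton_nonempty v, fun h => by
    have hv : (v : P) ∈ upperBounds
        (Subtype.val '' (({v} : Finset (posetAtoms P)) : Set (posetAtoms P))) := by simp
    rw [GeneratesPoset] at h
    rw [h] at hv
    exact hv⟩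

/-- `X` is a left coset of a proper subgroup of `G`. -/
def IsProperCoset {G : Type*} [Group G] (X : Set G) : Prop :=
  ∃ (H : Subgroup G) (x : G), H ≠ ⊤ ∧ X = (fun h => x * h) '' (H : Set G)

/-- The coset poset `C(G)`: all left cosets of all proper subgroups of `G`, ordered by inclusion. -/
abbrev CosetPoset (G : Type*) [Group G] : Type _ := {X : Set G // IsProperCoset X}

/-- The complex `M(G)`: its simplices are the (finite, nonempty) subsets of `G` that are contained
in a proper coset. -/
def groupMinimalCover (G : Type*) [Group G] : PreAbstractSimplicialComplex G where
  faces := {s | s.Nonempty ∧ ∃ X : Set G, IsProperCoset X ∧ (s : Set G) ⊆ X}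
  isRelLowerSet_faces := fun _ ⟨hne, X, hX, hsX⟩ =>
    ⟨hne, fun _ hts ht => ⟨ht, X, hX, (Finset.coe_subset.2 hts).trans hsX⟩⟩

/-! For (1), explicit maps go both ways. The map `f : |Δ(P)| → |M(P)|` spreads mass over the atoms
below its location; `g : |M(P)| → |Δ(P)|` combines the joins of the superlevel sets of a point.
Superlevel sets are nested, so their joins form a chain; atomizedness supplies the joins.

A point `t` and `f (g t)` are both supported on the atoms below the join of the support of `t`, so a
straight-line homotopy suffices (`homotopic_of_contiguous`). In the other order, the weight `f u`
gives an atom is, up to scale, the `u`-mass of the chain elements above it. Hence its superlevel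
sets are sets of all atoms below some chain element, and `g (f u)` is supported on the image of the
support of `u` under `r`, where `r p` is the join of the atoms below `p`. Since `r` is monotone and
`r ≤ id`, `homotopic_id_of_support_subset_image` applies.

For (2), proper cosets through a common point intersect in a proper coset, so `C(G)` is atomized;
for nontrivial `G` its atoms are the singletons, and (1) applies. -/

/-! ### Maps and homotopies into geometric realizations -/

section Realization

variable {V X : Type*} [Fintype V] {K : PreAbstractSimplicialComplex V} [TopologicalSpace X]

/-- A face containing the support is enough: the exact support is nonempty because the total mass is
1, and it inherits being a face by downward closure. -/
theorem mem_geometricRealization {t : V → ℝ} {s : Finset V} (h0 : ∀ v, 0 ≤ t v)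
    (h1 : ∑ v, t v = 1) (hs : s ∈ K.faces) (hts : Function.support t ⊆ s) :
    t ∈ geometricRealization K := by
  classical
  have hne : (Finset.univ.filter fun v => t v ≠ 0).Nonempty := by
    by_contra h
    rw [Finset.not_nonempty_iff_eq_empty, Finset.filter_eq_empty_iff] at h
    have : ∑ v, t v = 0 := Finset.sum_eq_zero fun v hv => not_not.1 (h hv)
    linarith
  refine ⟨h0, Finset.univ.filter fun v => t v ≠ 0, ?_, ?_, ?_⟩
  · refine (K.isRelLowerSet_faces hs).2 ?_ hne
    intro v hv
    exact hts (Finset.mem_filter.1 hv).2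
  · ext v
    simp
  · rw [Finset.sum_filter_ne_zero, h1]

theorem geometricRealization_sum_eq_one {t : V → ℝ} (ht : t ∈ geometricRealization K) :
    ∑ v, t v = 1 := by
  obtain ⟨_, s, -, hs, h1⟩ := ht
  rw [← h1]
  refine (Finset.sum_subset (Finset.subset_univ s) fun v _ hv => ?_).symm
  rw [← Finset.mem_coe, hs] at hv
  exact Function.notMem_support.1 hv

theorem geometricRealization_exists_ne_zero {t : V → ℝ} (ht : t ∈ geometricRealization K) :
    ∃ v, 0 < t v := by
  by_contra! h
  have := Finset.sum_nonpos fun v (_ : v ∈ Finset.univ) => h v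
  linarith [geometricRealization_sum_eq_one ht]

/-- A continuous family of nonzero nonnegative weights supported on simplices of `K`, normalized to
a continuous map into the realization. -/
theorem exists_map_geometricRealization_of_weights (w : X → V → ℝ) (hw : Continuous w)
    (h0 : ∀ x v, 0 ≤ w x v) (hpos : ∀ x, ∃ v, w x v ≠ 0)
    (hK : ∀ x, ∃ s ∈ K.faces, Function.support (w x) ⊆ s) :
    ∃ f : C(X, geometricRealization K), ∀ x, ∃ c : ℝ, 0 < c ∧
      ∀ v, (f x : V → ℝ) v = w x v / c := by
  have hc : ∀ x, 0 < ∑ v, w x v := fun x => by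
    obtain ⟨v, hv⟩ := hpos x
    exact Finset.sum_pos' (fun v _ => h0 x v)
      ⟨v, Finset.mem_univ v, lt_of_le_of_ne (h0 x v) hv.symm⟩
  have hmem : ∀ x, (fun v => w x v / ∑ v, w x v) ∈ geometricRealization K := fun x => by
    obtain ⟨s, hs, hws⟩ := hK x
    refine mem_geometricRealization (fun v => div_nonneg (h0 x v) (hc x).le) ?_ hs ?_
    · rw [← Finset.sum_div, div_self (hc x).ne']
    · intro v hv
      refine hws fun h => hv ?_
      simp [h]
  refine ⟨⟨fun x => ⟨_, hmem x⟩, ?_⟩, fun x => ⟨_, hc x, fun v => rfl⟩⟩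
  refine Continuous.subtype_mk (continuous_pi fun v => ?_) _
  exact Continuous.div (by fun_prop) (by fun_prop) fun x => (hc x).ne'

/-- Contiguous maps into a realization are homotopic. -/
theorem homotopic_of_contiguous (f g : C(X, geometricRealization K))
    (h : ∀ x, ∃ s ∈ K.faces, Function.support (f x : V → ℝ) ⊆ s ∧
      Function.support (g x : V → ℝ) ⊆ s) : f.Homotopic g := by
  have hmem : ∀ y : unitInterval × X, (fun v => (1 - (y.1 : ℝ)) * (f y.2 : V → ℝ) v
      + y.1 * (g y.2 : V → ℝ) v) ∈ geometricRealization K := by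
    rintro ⟨τ, x⟩
    obtain ⟨s, hs, hf, hg⟩ := h x
    refine mem_geometricRealization (fun v => ?_) ?_ hs ?_
    · exact add_nonneg (mul_nonneg (sub_nonneg.2 τ.2.2) ((f x).2.1 v))
        (mul_nonneg τ.2.1 ((g x).2.1 v))
    · rw [Finset.sum_add_distrib, ← Finset.mul_sum, ← Finset.mul_sum,
        geometricRealization_sum_eq_one (f x).2, geometricRealization_sum_eq_one (g x).2]
      ring
    · intro v hv
      by_contra hvs
      have hfv : (f x : V → ℝ) v = 0 := Function.notMem_support.1 fun h => hvs (hf h)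
      have hgv : (g x : V → ℝ) v = 0 := Function.notMem_support.1 fun h => hvs (hg h)
      exact hv (by simp [hfv, hgv])
  refine ⟨⟨⟨fun y => ⟨_, hmem y⟩, ?_⟩, fun x => ?_, fun x => ?_⟩⟩
  · refine Continuous.subtype_mk (continuous_pi fun v => ?_) _
    have hf : Continuous fun y : unitInterval × X => (f y.2 : V → ℝ) v :=
      (continuous_apply v).comp (continuous_subtype_val.comp (f.continuous.comp continuous_snd))
    have hg : Continuous fun y : unitInterval × X => (g y.2 : V → ℝ) v :=
      (continuous_apply v).comp (continuous_subtype_val.comp (g.continuous.comp continuous_snd))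
    have hτ : Continuous fun y : unitInterval × X => (y.1 : ℝ) :=
      continuous_subtype_val.comp continuous_fst
    exact ((continuous_const.sub hτ).mul hf).add (hτ.mul hg)
  · ext v
    simp
  · ext v
    simp

/-- A bijection of vertices that identifies the simplices induces a homeomorphism of the
realizations. -/
theorem nonempty_homeomorph_geometricRealization {W : Type*} [Fintype W]
    {L : PreAbstractSimplicialComplex W} (e : V ≃ W)
    (he : ∀ s : Finset V, s ∈ K.faces ↔ s.map e.toEmbedding ∈ L.faces) :
    Nonempty (geometricRealization K ≃ₜ geometricRealization L) := by
  have h1 : ∀ t ∈ geometricRealization K, t ∘ e.symm ∈ geometricRealization L := by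
    intro t ht
    obtain ⟨s, hs, hst, -⟩ := ht.2
    refine mem_geometricRealization (fun w => ht.1 _) ?_ ((he s).1 hs) ?_
    · rw [← geometricRealization_sum_eq_one ht]
      exact Equiv.sum_comp e.symm t
    · intro w hw
      have : e.symm w ∈ (s : Set V) := hst ▸ hw
      simpa using this
  have h2 : ∀ t ∈ geometricRealization L, t ∘ e ∈ geometricRealization K := by
    intro t ht
    obtain ⟨s, hs, hst, -⟩ := ht.2
    refine mem_geometricRealization (s := s.map e.symm.toEmbedding) (fun w => ht.1 _) ?_ ?_ ?_
    · rw [← geometricRealization_sum_eq_one ht]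
      exact Equiv.sum_comp e t
    · rw [he, Finset.map_map]
      convert hs
      ext w
      simp
    · intro v hv
      have : e v ∈ (s : Set W) := hst ▸ hv
      simpa using this
  have hc₁ : Continuous fun t : geometricRealization K => (t : V → ℝ) ∘ e.symm :=
    continuous_pi fun w => (continuous_apply (e.symm w)).comp continuous_subtype_val
  have hc₂ : Continuous fun t : geometricRealization L => (t : W → ℝ) ∘ e :=
    continuous_pi fun v => (continuous_apply (e v)).comp continuous_subtype_val
  exact ⟨{ toFun := fun t => ⟨_, h1 t t.2⟩
           invFun := fun t => ⟨_, h2 t t.2⟩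
           left_inv := fun t => by ext v; simp
           right_inv := fun t => by ext v; simp
           continuous_toFun := hc₁.subtype_mk _
           continuous_invFun := hc₂.subtype_mk _ }⟩

end Realization

/-! ### Homotopies of order complexes by moving mass from the bottom up -/

section OrderComplex

variable {P : Type*} [PartialOrder P] [Fintype P]

theorem isChain_support_of_mem_orderComplex {u : P → ℝ}
    (hu : u ∈ geometricRealization (orderComplex P).toPreAbstractSimplicialComplex) :
    IsChain (· ≤ ·) (Function.support u) := by
  obtain ⟨s, hs, hsu, -⟩ := hu.2
  exact hsu ▸ hs.2

theorem exists_face_orderComplex_of_isChain {u : P → ℝ} (hne : ∃ p, u p ≠ 0)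
    (hu : IsChain (· ≤ ·) (Function.support u)) :
    ∃ s ∈ (orderComplex P).toPreAbstractSimplicialComplex.faces,
      Function.support u ⊆ (s : Set P) := by
  classical
  obtain ⟨p, hp⟩ := hne
  have hs : ((Finset.univ.filter fun v => u v ≠ 0 : Finset P) : Set P) = Function.support u := by
    ext v
    simp
  exact ⟨Finset.univ.filter fun v => u v ≠ 0, ⟨⟨p, by simpa using hp⟩, hs ▸ hu⟩, hs.ge⟩

theorem mem_orderComplex_of_isChain {u : P → ℝ} (h0 : ∀ p, 0 ≤ u p) (h1 : ∑ p, u p = 1)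
    (hu : IsChain (· ≤ ·) (Function.support u)) :
    u ∈ geometricRealization (orderComplex P).toPreAbstractSimplicialComplex := by
  have hne : ∃ p, u p ≠ 0 := by
    by_contra! h
    simp [h] at h1
  obtain ⟨s, hs, hus⟩ := exists_face_orderComplex_of_isChain hne hu
  exact mem_geometricRealization h0 h1 hs hus

open Classical in
/-- The part of the mass `u p` that lies in the lowest `τ` of the total mass of a chain. -/
noncomputable def lowerMass (u : P → ℝ) (τ : ℝ) (p : P) : ℝ :=
  min (max (τ - ∑ q with q < p, u q) 0) (u p)

open Classical in
/-- The mass distribution obtained from `u` by moving the lowest `τ` of its mass along `r`. -/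
noncomputable def pushLowerMass (r : P → P) (u : P → ℝ) (τ : ℝ) (q : P) : ℝ :=
  (∑ p, if r p = q then lowerMass u τ p else 0) + (u q - lowerMass u τ q)

theorem lowerMass_nonneg {u : P → ℝ} (hu : ∀ p, 0 ≤ u p) (τ : ℝ) (p : P) :
    0 ≤ lowerMass u τ p :=
  le_min (le_max_right _ _) (hu p)

theorem lowerMass_le (u : P → ℝ) (τ : ℝ) (p : P) : lowerMass u τ p ≤ u p :=
  min_le_right _ _

theorem lowerMass_zero {u : P → ℝ} (hu : ∀ p, 0 ≤ u p) (p : P) : lowerMass u 0 p = 0 := by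
  classical
  have : 0 ≤ ∑ q with q < p, u q := Finset.sum_nonneg fun q _ => hu q
  rw [lowerMass, max_eq_right (by convert sub_nonpos.2 this), min_eq_left (hu p)]

theorem sum_lt_add_le_of_lt {u : P → ℝ} [DecidableRel (α := P) (· < ·)] (hu : ∀ p, 0 ≤ u p)
    {q p : P} (hqp : q < p) :
    (∑ x with x < q, u x) + u q ≤ ∑ x with x < p, u x := by
  classical
  have hq : q ∉ Finset.univ.filter fun x => x < q := by simp
  rw [add_comm, ← Finset.sum_insert hq]
  refine Finset.sum_le_sum_of_subset_of_nonneg ?_ fun x _ _ => hu x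
  intro x hx
  simp only [Finset.mem_insert, Finset.mem_filter, Finset.mem_univ, true_and] at hx ⊢
  rcases hx with rfl | hx
  · exact hqp
  · exact hx.trans hqp

theorem lowerMass_one {u : P → ℝ} (hu : ∀ p, 0 ≤ u p) (h1 : ∑ p, u p = 1) (p : P) :
    lowerMass u 1 p = u p := by
  classical
  have hp : p ∉ Finset.univ.filter fun x => x < p := by simp
  have : u p + (∑ x with x < p, u x) ≤ 1 := by
    rw [← Finset.sum_insert hp, ← h1]
    exact Finset.sum_le_sum_of_subset_of_nonneg (Finset.subset_univ _) fun x _ _ => hu x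
  refine min_eq_right (le_max_of_le_left ?_)
  have h2 : u p ≤ 1 - ∑ x with x < p, u x := by linarith
  convert h2

/-- Stack the masses from the bottom of the chain. If `q < p`, the interval of `q` ends before that
of `p` starts; but level `τ` lies strictly below the end of the former and strictly above the start
of the latter. -/
theorem not_lt_of_lowerMass {u : P → ℝ} (hu : ∀ p, 0 ≤ u p) {τ : ℝ} {p q : P}
    (hp : 0 < lowerMass u τ p) (hq : lowerMass u τ q < u q) : ¬ q < p := by
  classical
  intro hqp
  have h1 := (lt_min_iff.1 hp).1
  have h2 : (max (τ - ∑ x with x < q, u x) 0) < u q := by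
    rcases min_lt_iff.1 hq with h | h
    · convert h
    · exact absurd h (lt_irrefl _)
  have h3 := (max_lt_iff.1 h2).1
  have h4 := sum_lt_add_le_of_lt hu hqp
  rcases lt_max_iff.1 h1 with h | h
  · have h5 : 0 < τ - ∑ x with x < p, u x := by convert h
    linarith
  · exact absurd h (lt_irrefl _)

theorem pushLowerMass_nonneg (r : P → P) {u : P → ℝ} (hu : ∀ p, 0 ≤ u p) (τ : ℝ) (q : P) :
    0 ≤ pushLowerMass r u τ q := by
  refine add_nonneg (Finset.sum_nonneg fun p _ => ?_) (sub_nonneg.2 (lowerMass_le u τ q))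
  split_ifs
  exacts [lowerMass_nonneg hu τ p, le_rfl]

theorem sum_pushLowerMass (r : P → P) (u : P → ℝ) (τ : ℝ) :
    ∑ q, pushLowerMass r u τ q = ∑ q, u q := by
  classical
  have h : ∑ q, ∑ p, (if r p = q then lowerMass u τ p else 0) = ∑ p, lowerMass u τ p := by
    rw [Finset.sum_comm]
    exact Finset.sum_congr rfl fun p _ => by simp
  have h' : ∑ q, pushLowerMass r u τ q =
      ∑ q, ((∑ p, if r p = q then lowerMass u τ p else 0) + (u q - lowerMass u τ q)) := by
    unfold pushLowerMass
    congr! 4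
  rw [h', Finset.sum_add_distrib, Finset.sum_sub_distrib, h]
  ring

theorem pushLowerMass_ne_zero {r : P → P} {u : P → ℝ} (hu : ∀ p, 0 ≤ u p) {τ : ℝ} {q : P}
    (h : pushLowerMass r u τ q ≠ 0) :
    (∃ p, 0 < lowerMass u τ p ∧ r p = q) ∨ lowerMass u τ q < u q := by
  by_contra! hc
  refine h ?_
  have h2 : u q - lowerMass u τ q = 0 :=
    sub_eq_zero.2 (le_antisymm hc.2 (lowerMass_le u τ q))
  rw [pushLowerMass, h2, add_zero]
  refine Finset.sum_eq_zero fun p _ => ?_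
  split_ifs with hp
  · by_contra h0
    exact hc.1 p (lt_of_le_of_ne (lowerMass_nonneg hu τ p) (Ne.symm h0)) hp
  · rfl

/-- A linear homotopy could leave the complex, since for `p < q` in a chain `r q` and `p` may be
incomparable. Moving the lowest mass first avoids this: if some mass at `p` has moved and some at
`q` remains, then `p ≤ q`, so `r p ≤ p ≤ q`. -/
theorem isChain_support_pushLowerMass {r : P → P} (hr : Monotone r) (hle : ∀ p, r p ≤ p)
    {u : P → ℝ} (hu : ∀ p, 0 ≤ u p) (hchain : IsChain (· ≤ ·) (Function.support u)) (τ : ℝ) :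
    IsChain (· ≤ ·) (Function.support (pushLowerMass r u τ)) := by
  have hsupp : ∀ {p}, 0 < lowerMass u τ p → p ∈ Function.support u := fun {p} hp =>
    (hp.trans_le (lowerMass_le u τ p)).ne'
  have hsupp' : ∀ {p}, lowerMass u τ p < u p → p ∈ Function.support u := fun {p} hp =>
    ((lowerMass_nonneg hu τ p).trans_lt hp).ne'
  have key : ∀ {p q}, 0 < lowerMass u τ p → lowerMass u τ q < u q → r p ≤ q := by
    intro p q hp hq
    refine (hle p).trans ?_
    rcases hchain.total (hsupp hp) (hsupp' hq) with h | h
    · exact h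
    · rcases h.eq_or_lt with h | h
      · exact h.ge
      · exact absurd h (not_lt_of_lowerMass hu hp hq)
  intro x hx y hy _
  rcases pushLowerMass_ne_zero hu hx with ⟨p, hp, rfl⟩ | hx <;>
    rcases pushLowerMass_ne_zero hu hy with ⟨q, hq, rfl⟩ | hy
  · exact (hchain.total (hsupp hp) (hsupp hq)).imp (fun h => hr h) (fun h => hr h)
  · exact Or.inl (key hp hy)
  · exact Or.inr (key hq hx)
  · exact hchain.total (hsupp' hx) (hsupp' hy)

/-- A self-map of `|Δ(P)|` that carries each point into the image of its carrier under a monotone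
map `r ≤ id` is homotopic to the identity. -/
theorem homotopic_id_of_support_subset_image {r : P → P} (hr : Monotone r) (hle : ∀ p, r p ≤ p)
    (f : C(geometricRealization (orderComplex P).toPreAbstractSimplicialComplex,
      geometricRealization (orderComplex P).toPreAbstractSimplicialComplex))
    (hf : ∀ u, Function.support (f u : P → ℝ) ⊆ r '' Function.support (u : P → ℝ)) :
    f.Homotopic (ContinuousMap.id _) := by
  classical
  let X := geometricRealization (orderComplex P).toPreAbstractSimplicialComplex
  have hmem : ∀ y : unitInterval × X, pushLowerMass r (y.2 : P → ℝ) y.1 ∈ X := fun y =>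
    mem_orderComplex_of_isChain (pushLowerMass_nonneg r y.2.2.1 _)
      ((sum_pushLowerMass r _ _).trans (geometricRealization_sum_eq_one y.2.2))
      (isChain_support_pushLowerMass hr hle y.2.2.1 (isChain_support_of_mem_orderComplex y.2.2) _)
  have hcont : Continuous fun y : unitInterval × X => (⟨_, hmem y⟩ : X) := by
    refine Continuous.subtype_mk (continuous_pi fun q => ?_) _
    have hu : ∀ p, Continuous fun y : unitInterval × X => (y.2 : P → ℝ) p := fun p =>
      (continuous_apply p).comp (continuous_subtype_val.comp continuous_snd)
    have hl : ∀ p, Continuous fun y : unitInterval × X => lowerMass (y.2 : P → ℝ) y.1 p :=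
      fun p => by
        unfold lowerMass
        exact (((continuous_subtype_val.comp continuous_fst).sub
          (continuous_finsetSum _ fun q _ => hu q)).max continuous_const).min (hu p)
    unfold pushLowerMass
    refine (continuous_finsetSum _ fun p _ => ?_).add ((hu q).sub (hl q))
    split_ifs
    exacts [hl p, continuous_const]
  let H : C(unitInterval × X, X) := ⟨_, hcont⟩
  let H₀ : C(X, X) := H.comp ⟨fun x => (0, x), by fun_prop⟩
  let H₁ : C(X, X) := H.comp ⟨fun x => (1, x), by fun_prop⟩
  have hH : H₀.Homotopic H₁ := ⟨⟨H, fun _ => rfl, fun _ => rfl⟩⟩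
  have h₀ : H₀ = ContinuousMap.id _ := by
    ext u q
    change pushLowerMass r (u : P → ℝ) ((0 : unitInterval) : ℝ) q = (u : P → ℝ) q
    simp [pushLowerMass, lowerMass_zero u.2.1]
  have h₁ : H₁.Homotopic f := by
    -- At time 1 all mass has moved along `r`, so both points are supported on the chain `r(s)`,
    -- with `s` the support of `u`.
    refine homotopic_of_contiguous _ _ fun u => ?_
    obtain ⟨s, hs, hsu, -⟩ := u.2.2
    refine ⟨s.image r, ⟨hs.1.image r, ?_⟩, ?_, ?_⟩
    · rw [Finset.coe_image]
      rintro _ ⟨p, hp, rfl⟩ _ ⟨q, hq, rfl⟩ _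
      exact (hs.2.total hp hq).imp (fun h => hr h) (fun h => hr h)
    · intro q hq
      have hq' : pushLowerMass r (u : P → ℝ) ((1 : unitInterval) : ℝ) q ≠ 0 := hq
      rw [Set.Icc.coe_one] at hq'
      have h1 := lowerMass_one u.2.1 (geometricRealization_sum_eq_one u.2)
      rw [Finset.coe_image, hsu]
      rcases pushLowerMass_ne_zero u.2.1 hq' with ⟨p, hp, rfl⟩ | h
      · rw [h1] at hp
        exact ⟨p, hp.ne', rfl⟩
      · exact absurd (h1 q) h.ne
    · rw [Finset.coe_image, hsu]
      exact hf u
  rw [← h₀]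
  exact (hH.trans h₁).symm

end OrderComplex

/-! ### The homotopy equivalence for atomized posets -/

section Atomized

variable {P : Type*} [PartialOrder P]

theorem mem_faces_minimalCover {s : Finset (posetAtoms P)} :
    s ∈ (minimalCover P).toPreAbstractSimplicialComplex.faces ↔
      s.Nonempty ∧ ∃ p : P, ∀ a ∈ s, (a : P) ≤ p := by
  refine and_congr_right fun _ => ?_
  rw [GeneratesPoset, ← ne_eq, ← Set.nonempty_iff_ne_empty]
  refine exists_congr fun p => ?_
  simp [mem_upperBounds]

variable [Fintype P]

theorem exists_atom_le (p : P) : ∃ a : posetAtoms P, (a : P) ≤ p := by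
  obtain ⟨a, hap, ha⟩ := exists_minimal_le_of_wellFoundedLT (fun _ : P => True) p trivial
  exact ⟨⟨a, fun b hb => ha.2 trivial hb⟩, hap⟩

/-- The map `|Δ(P)| → |M(P)|` that spreads the mass at each `p` over the atoms below `p`. -/
theorem exists_map_orderComplex_minimalCover [Fintype (posetAtoms P)] :
    ∃ f : C(geometricRealization (orderComplex P).toPreAbstractSimplicialComplex,
        geometricRealization (minimalCover P).toPreAbstractSimplicialComplex),
      (∀ u a, (f u : posetAtoms P → ℝ) a ≠ 0 → ∃ p, (u : P → ℝ) p ≠ 0 ∧ (a : P) ≤ p) ∧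
      (∀ (u : geometricRealization (orderComplex P).toPreAbstractSimplicialComplex)
        (a b : posetAtoms P),
        (∀ q, (u : P → ℝ) q ≠ 0 → (a : P) ≤ q → (b : P) ≤ q) →
        (f u : posetAtoms P → ℝ) a ≤ (f u : posetAtoms P → ℝ) b) ∧
      ∀ (u : geometricRealization (orderComplex P).toPreAbstractSimplicialComplex)
        (a b : posetAtoms P),
        (∀ q, (u : P → ℝ) q ≠ 0 → (a : P) ≤ q → (b : P) ≤ q) →
        (∃ q, (u : P → ℝ) q ≠ 0 ∧ (b : P) ≤ q ∧ ¬ (a : P) ≤ q) →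
        (f u : posetAtoms P → ℝ) a < (f u : posetAtoms P → ℝ) b := by
  classical
  let X := geometricRealization (orderComplex P).toPreAbstractSimplicialComplex
  let w : X → posetAtoms P → ℝ := fun u a => ∑ p, if (a : P) ≤ p then (u : P → ℝ) p else 0
  have hterm : ∀ (u : X) (a : posetAtoms P) p,
      0 ≤ if (a : P) ≤ p then (u : P → ℝ) p else 0 := fun u a p => by
    split_ifs
    exacts [u.2.1 p, le_rfl]
  have hw0 : ∀ u a, 0 ≤ w u a := fun u a => Finset.sum_nonneg fun p _ => hterm u a p
  have hne : ∀ u a, w u a ≠ 0 → ∃ p, (u : P → ℝ) p ≠ 0 ∧ (a : P) ≤ p := by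
    intro u a h
    obtain ⟨p, -, hp⟩ := Finset.exists_ne_zero_of_sum_ne_zero h
    split_ifs at hp with hap
    · exact ⟨p, hp, hap⟩
    · exact absurd rfl hp
  have hle : ∀ (u : X) (a b : posetAtoms P),
      (∀ q, (u : P → ℝ) q ≠ 0 → (a : P) ≤ q → (b : P) ≤ q) → ∀ q,
      (if (a : P) ≤ q then (u : P → ℝ) q else 0) ≤ if (b : P) ≤ q then (u : P → ℝ) q else 0 := by
    intro u a b h q
    by_cases hq : (u : P → ℝ) q = 0
    · simp [hq]
    · by_cases haq : (a : P) ≤ q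
      · rw [if_pos haq, if_pos (h q hq haq)]
      · rw [if_neg haq]
        exact hterm u b q
  have hcont : Continuous w := by
    refine continuous_pi fun a => continuous_finsetSum _ fun p _ => ?_
    split_ifs
    · exact (continuous_apply p).comp continuous_subtype_val
    · exact continuous_const
  have hpos : ∀ u, ∃ a, w u a ≠ 0 := by
    intro u
    obtain ⟨p, hp⟩ := geometricRealization_exists_ne_zero u.2
    obtain ⟨a, ha⟩ := exists_atom_le p
    refine ⟨a, (Finset.sum_pos' (fun p _ => hterm u a p) ⟨p, Finset.mem_univ p, ?_⟩).ne'⟩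
    rwa [if_pos ha]
  have hK : ∀ u, ∃ s ∈ (minimalCover P).toPreAbstractSimplicialComplex.faces, Function.support (w u) ⊆ s := by
    intro u
    obtain ⟨s, hs, hsu, -⟩ := u.2.2
    -- The top `m` of the chain bounds every atom that receives weight.
    obtain ⟨m, hm⟩ := s.exists_maximal hs.1
    obtain ⟨a, ha⟩ := exists_atom_le m
    refine ⟨Finset.univ.filter fun a => (a : P) ≤ m,
      mem_faces_minimalCover.2 ⟨⟨a, by simpa using ha⟩, m, fun a ha => (Finset.mem_filter.1 ha).2⟩,
      fun b hb => ?_⟩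
    obtain ⟨p, hp, hbp⟩ := hne u b hb
    have hps : p ∈ (s : Set P) := hsu ▸ hp
    have : p ≤ m := (hs.2.total hps hm.1).elim id fun h => hm.2 hps h
    simpa using hbp.trans this
  obtain ⟨f, hf⟩ := exists_map_geometricRealization_of_weights
    (K := (minimalCover P).toPreAbstractSimplicialComplex) w hcont hw0 hpos hK
  refine ⟨f, fun u a h => ?_, fun u a b h => ?_, fun u a b h h' => ?_⟩
  · obtain ⟨c, -, hfc⟩ := hf u
    exact hne u a fun h0 => h (by rw [hfc, h0, zero_div])
  · obtain ⟨c, hc, hfc⟩ := hf u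
    rw [hfc, hfc]
    exact div_le_div_of_nonneg_right (Finset.sum_le_sum fun q _ => hle u a b h q) hc.le
  · obtain ⟨c, hc, hfc⟩ := hf u
    rw [hfc, hfc]
    refine div_lt_div_of_pos_right (Finset.sum_lt_sum (fun q _ => hle u a b h q) ?_) hc
    obtain ⟨q, hq, hbq, haq⟩ := h'
    refine ⟨q, Finset.mem_univ q, ?_⟩
    rw [if_neg haq, if_pos hbq]
    exact lt_of_le_of_ne (u.2.1 q) hq.symm

/-- The map `|M(P)| → |Δ(P)|` that sends a point to a combination of the least upper bounds of its
superlevel sets. -/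
theorem exists_map_minimalCover_orderComplex [Fintype (posetAtoms P)] (hP : IsAtomized P) :
    ∃ f : C(geometricRealization (minimalCover P).toPreAbstractSimplicialComplex,
        geometricRealization (orderComplex P).toPreAbstractSimplicialComplex),
      ∀ t p, (f t : P → ℝ) p ≠ 0 → ∃ s : Set (posetAtoms P), s.Nonempty ∧
        IsLeast (upperBounds (Subtype.val '' s)) p ∧ (∀ a ∈ s, (t : posetAtoms P → ℝ) a ≠ 0) ∧
        ∀ a ∈ s, ∀ b ∉ s, (t : posetAtoms P → ℝ) b < (t : posetAtoms P → ℝ) a := by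
  classical
  let X := geometricRealization (minimalCover P).toPreAbstractSimplicialComplex
  -- A continuous indicator of superlevel sets: the product vanishes unless `t` is positive on `s`
  -- and every value on `s` exceeds every value off `s`.
  let c : X → Finset (posetAtoms P) → ℝ := fun t s =>
    ∏ a ∈ s, ((t : posetAtoms P → ℝ) a *
      ∏ b ∈ sᶜ, max 0 ((t : posetAtoms P → ℝ) a - (t : posetAtoms P → ℝ) b))
  have hc0 : ∀ t s, 0 ≤ c t s := fun t s => Finset.prod_nonneg fun a _ =>
    mul_nonneg (t.2.1 a) (Finset.prod_nonneg fun b _ => le_max_left _ _)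
  have hc : ∀ t s, c t s ≠ 0 → (∀ a ∈ s, (t : posetAtoms P → ℝ) a ≠ 0) ∧
      ∀ a ∈ s, ∀ b ∉ s, (t : posetAtoms P → ℝ) b < (t : posetAtoms P → ℝ) a := by
    intro t s h
    have h' := Finset.prod_ne_zero_iff.1 h
    refine ⟨fun a ha => left_ne_zero_of_mul (h' a ha), fun a ha b hb => ?_⟩
    have := Finset.prod_ne_zero_iff.1 (right_ne_zero_of_mul (h' a ha)) b (by simpa using hb)
    by_contra! hba
    exact this (max_eq_left (sub_nonpos.2 hba))
  let w : X → P → ℝ := fun t p => ∑ s : Finset (posetAtoms P),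
    if s.Nonempty ∧ IsLeast (upperBounds (Subtype.val '' (s : Set (posetAtoms P)))) p
      then c t s else 0
  have hterm : ∀ t p (s : Finset (posetAtoms P)), 0 ≤
      if s.Nonempty ∧ IsLeast (upperBounds (Subtype.val '' (s : Set (posetAtoms P)))) p
        then c t s else 0 := fun t p s => by
    split_ifs
    exacts [hc0 t s, le_rfl]
  have hne : ∀ t p, w t p ≠ 0 → ∃ s : Finset (posetAtoms P), s.Nonempty ∧
      IsLeast (upperBounds (Subtype.val '' (s : Set (posetAtoms P)))) p ∧
      (∀ a ∈ s, (t : posetAtoms P → ℝ) a ≠ 0) ∧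
      ∀ a ∈ s, ∀ b ∉ s, (t : posetAtoms P → ℝ) b < (t : posetAtoms P → ℝ) a := by
    intro t p h
    obtain ⟨s, -, hs⟩ := Finset.exists_ne_zero_of_sum_ne_zero h
    split_ifs at hs with hsp
    · exact ⟨s, hsp.1, hsp.2, hc t s hs⟩
    · exact absurd rfl hs
  have hpos : ∀ t, ∃ p, w t p ≠ 0 := by
    intro t
    -- The full support of `t` always has positive weight, and it has a join because it does not
    -- generate `P`.
    obtain ⟨s, hs, hst, -⟩ := t.2.2
    have hmem : ∀ a, a ∈ s ↔ (t : posetAtoms P → ℝ) a ≠ 0 := fun a => by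
      rw [← Finset.mem_coe, hst, Function.mem_support]
    obtain ⟨m, hm⟩ := (hP (Subtype.val '' (s : Set (posetAtoms P)))
      (by rintro _ ⟨a, -, rfl⟩; exact a.2) (hs.1.to_set.image _)).resolve_left hs.2
    refine ⟨m, (Finset.sum_pos' (fun s _ => hterm t m s) ⟨s, Finset.mem_univ s, ?_⟩).ne'⟩
    rw [if_pos ⟨hs.1, hm⟩]
    refine Finset.prod_pos fun a ha => ?_
    have hta : 0 < (t : posetAtoms P → ℝ) a :=
      lt_of_le_of_ne (t.2.1 a) (Ne.symm ((hmem a).1 ha))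
    refine mul_pos hta (Finset.prod_pos fun b hb => ?_)
    have htb : (t : posetAtoms P → ℝ) b = 0 :=
      not_not.1 fun h => Finset.mem_compl.1 hb ((hmem b).2 h)
    rw [htb, sub_zero]
    exact lt_max_of_lt_right hta
  have hcont : Continuous w := by
    refine continuous_pi fun p => continuous_finsetSum _ fun s _ => ?_
    have ht : ∀ a, Continuous fun t : X => (t : posetAtoms P → ℝ) a := fun a =>
      (continuous_apply a).comp continuous_subtype_val
    split_ifs
    · exact continuous_finsetProd _ fun a _ => (ht a).mul
        (continuous_finsetProd _ fun b _ => continuous_const.max ((ht a).sub (ht b)))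
    · exact continuous_const
  have hK : ∀ u, ∃ s ∈ (orderComplex P).toPreAbstractSimplicialComplex.faces, Function.support (w u) ⊆ s := by
    intro t
    refine exists_face_orderComplex_of_isChain (hpos t) ?_
    intro p hp q hq _
    obtain ⟨s, -, hsp, -, hs⟩ := hne t p hp
    obtain ⟨s', -, hsq, -, hs'⟩ := hne t q hq
    -- Two superlevel sets of the same `t` are nested, and joins respect inclusion.
    by_cases hss : s ⊆ s'
    · exact Or.inl (hsp.2 fun x hx => hsq.1 (Set.image_mono (Finset.coe_subset.2 hss) hx))
    · refine Or.inr (hsq.2 fun x hx => hsp.1 (Set.image_mono (Finset.coe_subset.2 ?_) hx))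
      intro b hb
      by_contra hbs
      obtain ⟨a, ha, has'⟩ := Finset.not_subset.1 hss
      exact lt_asymm (hs a ha b hbs) (hs' b hb a has')
  obtain ⟨f, hf⟩ := exists_map_geometricRealization_of_weights
    (K := (orderComplex P).toPreAbstractSimplicialComplex) w hcont
    (fun t p => Finset.sum_nonneg fun s _ => hterm t p s) hpos hK
  refine ⟨f, fun t p h => ?_⟩
  obtain ⟨d, -, hfd⟩ := hf t
  obtain ⟨s, hs⟩ := hne t p fun h0 => h (by rw [hfd, h0, zero_div])
  exact ⟨s, hs⟩

theorem IsAtomized.nonempty_homotopyEquiv (hP : IsAtomized P) :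
    Nonempty (geometricRealization (orderComplex P).toPreAbstractSimplicialComplex ≃ₕ
      geometricRealization (minimalCover P).toPreAbstractSimplicialComplex) := by
  classical
  have : Fintype (posetAtoms P) := Fintype.ofFinite _
  obtain ⟨f, hf, hfle, hflt⟩ := exists_map_orderComplex_minimalCover (P := P)
  obtain ⟨g, hg⟩ := exists_map_minimalCover_orderComplex hP
  -- The join of the atoms below `p` exists because `p` is itself an upper bound of them.
  have hr : ∀ p : P, ∃ m, IsLeast (upperBounds (Subtype.val '' {a : posetAtoms P | (a : P) ≤ p}))
      m := by
    intro p
    obtain ⟨a, ha⟩ := exists_atom_le p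
    have hne : {a : posetAtoms P | (a : P) ≤ p}.Nonempty := ⟨a, ha⟩
    refine (hP _ (by rintro _ ⟨a, -, rfl⟩; exact a.2) (hne.image _)).resolve_left ?_
    refine Set.Nonempty.ne_empty ⟨p, ?_⟩
    rintro _ ⟨b, hb, rfl⟩
    exact hb
  choose r hr using hr
  refine ⟨⟨f, g, ?_, ?_⟩⟩
  · refine homotopic_id_of_support_subset_image (r := r) ?_ ?_ _ ?_
    · intro p q hpq
      refine (hr p).2 fun x hx => (hr q).1 (Set.image_mono ?_ hx)
      exact fun a (ha : (a : P) ≤ p) => ha.trans hpq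
    · intro p
      refine (hr p).2 ?_
      rintro _ ⟨b, hb, rfl⟩
      exact hb
    · intro u p hp
      obtain ⟨s, hsne, hsp, hs0, hs⟩ := hg (f u) p hp
      -- Take `a` of least weight in the superlevel set `s`, and `q` the lowest element above `a` in
      -- the support of `u`. An atom not below `q` weighs strictly less than `a`, and an atom below
      -- `q` at least as much, so `s` is the set of atoms below `q` and its join is `r q`.
      obtain ⟨a, has, hamin⟩ := Set.exists_min_image s (f u : posetAtoms P → ℝ) s.toFinite hsne
      obtain ⟨q₀, hq₀, haq₀⟩ := hf u a (hs0 a has)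
      have hchain := isChain_support_of_mem_orderComplex u.2
      obtain ⟨q, hq⟩ := Set.Finite.exists_minimal
        (Set.toFinite {q | (u : P → ℝ) q ≠ 0 ∧ (a : P) ≤ q}) ⟨q₀, hq₀, haq₀⟩
      have hleast : ∀ x, (u : P → ℝ) x ≠ 0 → (a : P) ≤ x → q ≤ x := fun x hx hax =>
        (hchain.total hq.1.1 hx).elim id fun h => hq.2 ⟨hx, hax⟩ h
      have hsq : s = {b : posetAtoms P | (b : P) ≤ q} := by
        ext b
        constructor
        · intro hb
          by_contra hbq
          refine (hflt u b a (fun x hx hbx => ?_) ⟨q, hq.1.1, hq.1.2, hbq⟩).not_ge (hamin b hb)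
          rcases hchain.total hq.1.1 hx with h | h
          · exact hq.1.2.trans h
          · exact absurd (hbx.trans h) hbq
        · intro hb
          by_contra hbs
          exact (hs a has b hbs).not_ge
            (hfle u a b fun x hx hax => le_trans hb (hleast x hx hax))
      exact ⟨q, hq.1.1, (hr q).unique (hsq ▸ hsp)⟩
  -- The common face is the set of atoms below the join `m` of the support of `t`: each join used by
  -- `g t` is that of a subset of the support, hence at most `m`.
  · refine homotopic_of_contiguous _ _ fun t => ?_
    obtain ⟨s, hs, hst, -⟩ := t.2.2
    obtain ⟨a, ha⟩ := hs.1
    obtain ⟨m, hm⟩ := (hP (Subtype.val '' (s : Set (posetAtoms P)))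
      (by rintro _ ⟨a, -, rfl⟩; exact a.2) (hs.1.to_set.image _)).resolve_left hs.2
    have hm' : ∀ a ∈ s, (a : P) ≤ m := fun a ha => hm.1 ⟨a, ha, rfl⟩
    refine ⟨Finset.univ.filter fun a => (a : P) ≤ m,
      mem_faces_minimalCover.2 ⟨⟨a, by simpa using hm' a ha⟩, m,
        fun a ha => (Finset.mem_filter.1 ha).2⟩, ?_, ?_⟩
    · intro b hb
      obtain ⟨p, hp, hbp⟩ := hf (g t) b hb
      obtain ⟨s', -, hs'p, hs'0, -⟩ := hg t p hp
      have hpm : p ≤ m := by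
        refine hs'p.2 ?_
        rintro _ ⟨x, hx, rfl⟩
        refine hm' x ?_
        rw [← Finset.mem_coe, hst]
        exact hs'0 x hx
      simpa using hbp.trans hpm
    · intro b hb
      have hbs : b ∈ (s : Set (posetAtoms P)) := hst ▸ hb
      simpa using hm' b hbs

end Atomized

/-! ### The coset poset of a finite group -/

section CosetPoset

variable {G : Type*} [Group G]

theorem mem_image_mul_left_iff {H : Subgroup G} {x y : G} :
    y ∈ (fun h => x * h) '' (H : Set G) ↔ x⁻¹ * y ∈ H := by
  constructor
  · rintro ⟨h, hh, rfl⟩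
    simpa using hh
  · exact fun h => ⟨_, h, by simp⟩

theorem IsProperCoset.nonempty {X : Set G} (hX : IsProperCoset X) : X.Nonempty := by
  obtain ⟨H, x, -, rfl⟩ := hX
  exact ⟨x, mem_image_mul_left_iff.2 (by simp)⟩

/-- Rebasing cosets at a shared point reduces their intersections to intersections of subgroups. -/
theorem IsProperCoset.exists_eq {X : Set G} (hX : IsProperCoset X) {g : G} (hg : g ∈ X) :
    ∃ H : Subgroup G, H ≠ ⊤ ∧ X = (fun h => g * h) '' (H : Set G) := by
  obtain ⟨H, x, hH, rfl⟩ := hX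
  refine ⟨H, hH, ?_⟩
  rw [mem_image_mul_left_iff] at hg
  ext y
  rw [mem_image_mul_left_iff, mem_image_mul_left_iff]
  have : x⁻¹ * y = (x⁻¹ * g) * (g⁻¹ * y) := by group
  rw [this, H.mul_mem_cancel_left hg]

theorem isAtomized_cosetPoset : IsAtomized (CosetPoset G) := by
  intro S _ hS
  obtain ⟨A, hA⟩ := hS
  obtain ⟨g, hg⟩ := A.2.nonempty
  rw [or_iff_not_imp_left, ← ne_eq, ← Set.nonempty_iff_ne_empty]
  rintro ⟨X, hX⟩
  -- Every upper bound of `S` contains `g`, hence is `gH` with `H ∈ T`, so `g (sInf T)` is the least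
  -- one. `T` also contains `⊤`; properness of `sInf T` comes from the given upper bound `X`.
  let T : Set (Subgroup G) := {H | ∀ B ∈ S, (B : Set G) ⊆ (fun h => g * h) '' (H : Set G)}
  have hT : ∀ Y ∈ upperBounds S, ∃ H ∈ T, H ≠ ⊤ ∧ (Y : Set G) = (fun h => g * h) '' (H : Set G) :=
    fun Y hY => by
      obtain ⟨H, hH, hYH⟩ := Y.2.exists_eq (hY hA hg)
      exact ⟨H, fun B hB => hYH ▸ hY hB, hH, hYH⟩
  obtain ⟨H, hHT, hH, -⟩ := hT X hX
  refine ⟨⟨_, sInf T, g, fun h => hH (top_le_iff.1 (h ▸ sInf_le hHT)), rfl⟩, ?_, ?_⟩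
  · intro B hB y hy
    rw [mem_image_mul_left_iff, Subgroup.mem_sInf]
    exact fun K hK => mem_image_mul_left_iff.1 (hK B hB hy)
  · intro Y hY
    obtain ⟨K, hKT, -, hYK⟩ := hT Y hY
    change _ ⊆ (Y : Set G)
    rw [hYK]
    exact Set.image_mono (sInf_le hKT : sInf T ≤ K)

theorem isProperCoset_singleton [Nontrivial G] (g : G) : IsProperCoset ({g} : Set G) :=
  ⟨⊥, g, bot_ne_top, by simp⟩

theorem singleton_mem_posetAtoms [Nontrivial G] (g : G) :
    (⟨{g}, isProperCoset_singleton g⟩ : CosetPoset G) ∈ posetAtoms (CosetPoset G) := by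
  intro X hX
  obtain ⟨x, hx⟩ := X.2.nonempty
  have hxg : x = g := hX hx
  rintro _ rfl
  exact hxg ▸ hx

theorem exists_eq_singleton_of_mem_posetAtoms [Nontrivial G] {X : CosetPoset G}
    (hX : X ∈ posetAtoms (CosetPoset G)) : ∃ g, (X : Set G) = {g} := by
  obtain ⟨g, hg⟩ := X.2.nonempty
  have hle : (⟨{g}, isProperCoset_singleton g⟩ : CosetPoset G) ≤ X :=
    Set.singleton_subset_iff.2 hg
  exact ⟨g, Set.Subset.antisymm (hX hle) hle⟩

theorem exists_equiv_posetAtoms_cosetPoset [Finite G] [Nontrivial G] :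
    ∃ e : G ≃ posetAtoms (CosetPoset G),
      (∀ g : G, ((e g : CosetPoset G) : Set G) = {g}) ∧
      ∀ s : Finset G, s ∈ (groupMinimalCover G).faces ↔
        s.map e.toEmbedding ∈ (minimalCover (CosetPoset G)).faces := by
  have : Fintype (CosetPoset G) := Fintype.ofFinite _
  let φ : G → posetAtoms (CosetPoset G) := fun g => ⟨_, singleton_mem_posetAtoms g⟩
  have hφ : Function.Bijective φ := by
    constructor
    · intro g h hgh
      exact Set.singleton_injective
        (congrArg (fun a : posetAtoms (CosetPoset G) => ((a : CosetPoset G) : Set G)) hgh)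
    · rintro ⟨X, hX⟩
      obtain ⟨g, hg⟩ := exists_eq_singleton_of_mem_posetAtoms hX
      exact ⟨g, Subtype.ext (Subtype.ext hg.symm)⟩
  refine ⟨Equiv.ofBijective φ hφ, fun g => rfl, fun s => ?_⟩
  rw [mem_faces_minimalCover, Finset.map_nonempty]
  refine and_congr_right fun _ => ⟨?_, ?_⟩
  · rintro ⟨X, hX, hsX⟩
    refine ⟨⟨X, hX⟩, fun a ha => ?_⟩
    obtain ⟨g, hg, rfl⟩ := Finset.mem_map.1 ha
    exact Set.singleton_subset_iff.2 (hsX hg)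
  · rintro ⟨X, hX⟩
    exact ⟨X, X.2, fun g hg =>
      Set.singleton_subset_iff.1 (hX _ (Finset.mem_map_of_mem _ hg))⟩

theorem isEmpty_cosetPoset [Subsingleton G] : IsEmpty (CosetPoset G) :=
  ⟨fun X => by
    obtain ⟨H, x, hH, -⟩ := X.2
    exact hH (Subsingleton.elim _ _)⟩

theorem nonempty_homotopyEquiv_groupMinimalCover [Finite G] :
    Nonempty (geometricRealization (orderComplex (CosetPoset G)).toPreAbstractSimplicialComplex ≃ₕ
      geometricRealization (groupMinimalCover G)) := by
  have : Fintype G := Fintype.ofFinite _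
  have : Fintype (CosetPoset G) := Fintype.ofFinite _
  have : Fintype (posetAtoms (CosetPoset G)) := Fintype.ofFinite _
  rcases subsingleton_or_nontrivial G with hG | hG
  -- For trivial `G` the singleton is not a proper coset, so atoms do not correspond to elements;
  -- instead both realizations are empty.
  · have := isEmpty_cosetPoset (G := G)
    have h1 : IsEmpty (geometricRealization
        (orderComplex (CosetPoset G)).toPreAbstractSimplicialComplex) :=
      ⟨fun u => by
        obtain ⟨p, -⟩ := geometricRealization_exists_ne_zero u.2
        exact isEmptyElim p⟩
    have h2 : IsEmpty (geometricRealization (groupMinimalCover G)) :=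
      ⟨fun u => by
        obtain ⟨s, ⟨-, X, hX, -⟩, -⟩ := u.2.2
        exact isEmptyElim (⟨X, hX⟩ : CosetPoset G)⟩
    exact ⟨(Homeomorph.empty).toHomotopyEquiv⟩
  · obtain ⟨e, -, he⟩ := exists_equiv_posetAtoms_cosetPoset (G := G)
    obtain ⟨h⟩ := nonempty_homeomorph_geometricRealization e he
    obtain ⟨k⟩ := (isAtomized_cosetPoset (G := G)).nonempty_homotopyEquiv
    exact ⟨k.trans h.symm.toHomotopyEquiv⟩

end CosetPoset

theorem mainTheorem2 (P : Type*) [PartialOrder P] [Finite P] (G : Type*) [Group G] [Finite G] :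
    (IsAtomized P →
      Nonempty (geometricRealization (orderComplex P).toPreAbstractSimplicialComplex ≃ₕ
        geometricRealization (minimalCover P).toPreAbstractSimplicialComplex)) ∧
    (IsAtomized (CosetPoset G) ∧
      Nonempty (geometricRealization (orderComplex (CosetPoset G)).toPreAbstractSimplicialComplex ≃ₕ
        geometricRealization (groupMinimalCover G)) ∧
      (Nontrivial G →
        (∀ g : G, {g} ∈ (groupMinimalCover G).faces) ∧
        ∃ e : G ≃ posetAtoms (CosetPoset G),
          (∀ g : G, ((e g : CosetPoset G) : Set G) = {g}) ∧
          ∀ s : Finset G,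
            s ∈ (groupMinimalCover G).faces ↔
              s.map e.toEmbedding ∈ (minimalCover (CosetPoset G)).faces)) := by
  refine ⟨fun hP => ?_, isAtomized_cosetPoset, nonempty_homotopyEquiv_groupMinimalCover,
    fun _ => ⟨fun g => ?_, exists_equiv_posetAtoms_cosetPoset⟩⟩
  · have := Fintype.ofFinite P
    exact hP.nonempty_homotopyEquiv
  · exact ⟨Finset.singleton_nonempty g, {g}, isProperCoset_singleton g, by simp⟩
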